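/- For non-negative integers $p,q$ let $C(p,q)=\dfrac{(2p)!\,(2q)!}{p!\,(p+q)!\,q!}$ be the bivariate Catalan number. For a permutation $\sigma$ of $\{1,\dots,n\}$, with the convention $\sigma(0)=0$, let \[p_-(\sigma)=\#\{i : 2\le i\le n-1,\ \sigma(i-1)<\sigma(i)>\sigma(i+1)\},\qquad p_+(\sigma)=\#\{i : 1\le i\le n-1,\ \sigma(i-1)<\sigma(i)>\sigma(i+1)\}\] be its numbers of interior peaks and of augmented peaks; both are at most $\lfloor n/2\rfloor$. Then, for every non-negative integer $n$, \[\sum_{\sigma\in S_n}(-1)^{p_-(\sigma)}\,C\bigl(p_-(\sigma),\lfloor n/2\rfloor-p_-(\sigma)\bigr)=4^{\lfloor n/2\rfloor},\] and, for every even positive integer $n$, \[\sum_{\sigma\in S_n}(-1)^{p_+(\sigma)}\,C\bigl(p_+(\sigma),n/2-p_+(\sigma)\bigr)=0.\] -/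

import Mathlib

/-- The bivariate Catalan number `C(m,n) = (2m)! (2n)! / (m! (m+n)! n!)`, as a rational number
(the division is the one of `ℚ`, so nothing is rounded). -/
def bivariateCatalan (m n : ℕ) : ℚ :=
  ((2 * m).factorial * (2 * n).factorial : ℚ) /
    (m.factorial * (m + n).factorial * n.factorial : ℚ)

/-- The one-line notation of a permutation `σ` of `{1, …, n}`: for `1 ≤ i ≤ n` this is `σ(i)`,
with letters in `{1, …, n}`, and `σ(0) = 0` by convention. The set `{1, …, n}` is modelled by
`Fin n`, the number `i` being the element `i - 1` of `Fin n`. The value for `i > n` is not used. -/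
def permWord {n : ℕ} (σ : Equiv.Perm (Fin n)) (i : ℕ) : ℕ :=
  if h : 1 ≤ i ∧ i ≤ n then (σ ⟨i - 1, by omega⟩ : ℕ) + 1 else 0

/-- The augmented peak set `{i ∈ {1, …, n-1} : σ(i-1) < σ(i) > σ(i+1)}`, where `σ(0) = 0`. -/
def augmentedPeakSet {n : ℕ} (σ : Equiv.Perm (Fin n)) : Finset ℕ :=
  (Finset.Ico 1 n).filter fun i =>
    permWord σ (i - 1) < permWord σ i ∧ permWord σ (i + 1) < permWord σ i

/-- The interior peak set `{i ∈ {1, …, n-1} : i ≠ 1, σ(i-1) < σ(i) > σ(i+1)}`. -/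
def interiorPeakSet {n : ℕ} (σ : Equiv.Perm (Fin n)) : Finset ℕ :=
  (Finset.Ico 1 n).filter fun i =>
    i ≠ 1 ∧ permWord σ (i - 1) < permWord σ i ∧ permWord σ (i + 1) < permWord σ i

/-- The number `p₊(σ)` of augmented peaks. -/
def augmentedPeakNumber {n : ℕ} (σ : Equiv.Perm (Fin n)) : ℕ := (augmentedPeakSet σ).card

/-- The number `p₋(σ)` of interior peaks. -/
def interiorPeakNumber {n : ℕ} (σ : Equiv.Perm (Fin n)) : ℕ := (interiorPeakSet σ).card

/-- There are at most `⌊n/2⌋` augmented peaks, so the subtraction `n / 2 - p₊(σ)` in `ℕ` never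
truncates. -/
theorem augmentedPeakNumber_le {n : ℕ} (σ : Equiv.Perm (Fin n)) :
    augmentedPeakNumber σ ≤ n / 2 := by
  have hd : Disjoint (augmentedPeakSet σ) ((augmentedPeakSet σ).image (· + 1)) := by
    rw [Finset.disjoint_left]
    intro i hi hi'
    obtain ⟨j, hj, rfl⟩ := Finset.mem_image.1 hi'
    simp only [augmentedPeakSet, Finset.mem_filter] at hi hj
    have h1 := hi.2.1
    have h2 := hj.2.2
    simp only [Nat.add_sub_cancel] at h1
    omega
  have hs : augmentedPeakSet σ ∪ (augmentedPeakSet σ).image (· + 1) ⊆ Finset.Icc 1 n := by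
    intro i hi
    simp only [augmentedPeakSet, Finset.mem_union, Finset.mem_image, Finset.mem_filter,
      Finset.mem_Ico] at hi
    rw [Finset.mem_Icc]
    rcases hi with hi | ⟨j, hj, rfl⟩ <;> omega
  have hc := Finset.card_le_card hs
  rw [Finset.card_union_of_disjoint hd,
    Finset.card_image_of_injective _ (add_left_injective 1), Nat.card_Icc] at hc
  unfold augmentedPeakNumber
  omega

/-- There are at most `⌊n/2⌋` interior peaks, so the subtraction `n / 2 - p₋(σ)` in `ℕ` never
truncates. -/
theorem interiorPeakNumber_le {n : ℕ} (σ : Equiv.Perm (Fin n)) :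
    interiorPeakNumber σ ≤ n / 2 := by
  refine le_trans (Finset.card_le_card fun i hi => ?_) (augmentedPeakNumber_le σ)
  simp only [interiorPeakSet, augmentedPeakSet, Finset.mem_filter] at hi ⊢
  exact ⟨hi.1, hi.2.2⟩

/-! Build S_{n+1} from S_n by inserting the letter n+1. Let p count the peaks at positions ≥ a, with
a = 1 for augmented and a = 2 for interior peaks. The new letter becomes a peak unless it lands
before position a or at the very end, and it destroys any peak it touches. Hence 2p + a of the n + 1
insertions keep p and the other n + 1 - a - 2p raise it by one (`sum_card_peakSet_insertWord`). Put
f(k) = (-1)^k C(k, N-k) into this recurrence. The relations (2m+1) C(k+1,m) = (2k+1) C(k,m+1) and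
C(k+1,m) + C(k,m+1) = 4 C(k,m) evaluate each summand separately. For augmented peaks every summand
vanishes when passing from odd to even length. For interior peaks the sum is unchanged from positive
even to odd length and is multiplied by 4 from odd to even. -/

/-! ### Peaks under insertion of a largest letter -/

/-- The peaks of the word `w` at positions in `[a, n)`. -/
def peakSet (a n : ℕ) (w : ℕ → ℕ) : Finset ℕ :=
  (Finset.Ico a n).filter fun i => w (i - 1) < w i ∧ w (i + 1) < w i

theorem mem_peakSet {a n : ℕ} {w : ℕ → ℕ} {i : ℕ} :
    i ∈ peakSet a n w ↔ (a ≤ i ∧ i < n) ∧ w (i - 1) < w i ∧ w (i + 1) < w i := by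
  simp [peakSet]

/-- The word obtained from `w` by inserting the letter `m` at position `J`. -/
def insertWord (J m : ℕ) (w : ℕ → ℕ) (i : ℕ) : ℕ :=
  if i < J then w i else if i = J then m else w (i - 1)

/-- Two adjacent positions are never both peaks. -/
theorem succ_notMem_peakSet {a n : ℕ} {w : ℕ → ℕ} {i : ℕ} (h : i ∈ peakSet a n w) :
    i + 1 ∉ peakSet a n w := by
  rw [mem_peakSet] at *
  simp only [Nat.add_sub_cancel]
  omega

/-- Only the old letters at J - 1 and J acquire the new letter as a neighbour, and being smaller
they cannot be peaks. Every other old letter keeps both neighbours, and those from J on shift by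
one. As `a ≤ 2`, no shifted letter crosses the left bound a. -/
theorem peakSet_insertWord {a n J : ℕ} {w : ℕ → ℕ} (hw : ∀ i, w i ≤ n) (ha : 1 ≤ a) (ha' : a ≤ 2)
    (hJ : 1 ≤ J) (hJn : J ≤ n + 1) :
    peakSet a (n + 1) (insertWord J (n + 1) w) =
      (if a ≤ J ∧ J ≤ n then {J} else ∅) ∪
        (((peakSet a n w).erase J).erase (J - 1)).image fun i => if i < J then i else i + 1 := by
  have hlt {i : ℕ} (h : i < J) : insertWord J (n + 1) w i = w i := by simp [insertWord, h]
  have heq : insertWord J (n + 1) w J = n + 1 := by simp [insertWord]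
  have hgt {i : ℕ} (h : J ≤ i) : insertWord J (n + 1) w (i + 1) = w i := by
    have h1 : ¬ i + 1 < J := by omega
    have h2 : ¬ i + 1 = J := by omega
    simp [insertWord, h1, h2]
  ext i
  simp only [Finset.mem_union, Finset.mem_image, Finset.mem_erase, mem_peakSet]
  rcases lt_trichotomy i J with h | rfl | h
  · have hiJ : i ∉ (if a ≤ J ∧ J ≤ n then ({J} : Finset ℕ) else ∅) := by
      split_ifs <;> simp [h.ne]
    by_cases h1 : i + 1 = J
    · have := hw i
      rw [h1, heq, hlt h]
      constructor
      · omega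
      · rintro (h2 | ⟨j, hj, hj'⟩)
        · exact absurd h2 hiJ
        · split_ifs at hj' <;> omega
    · rw [hlt h, hlt (by omega : i - 1 < J), hlt (by omega : i + 1 < J)]
      constructor
      · intro h2
        exact Or.inr ⟨i, ⟨by omega, by omega, by omega, h2.2⟩, if_pos h⟩
      · rintro (h2 | ⟨j, hj, hj'⟩)
        · exact absurd h2 hiJ
        · split_ifs at hj'
          · subst hj'
            exact ⟨by omega, hj.2.2.2⟩
          · omega
  · rw [heq, hlt (by omega : i - 1 < i), hgt le_rfl]
    have := hw i
    have := hw (i - 1)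
    constructor
    · intro h2
      left
      rw [if_pos (by omega)]
      simp
    · rintro (h2 | ⟨j, hj, hj'⟩)
      · split_ifs at h2 with h3
        · omega
        · simp at h2
      · split_ifs at hj' <;> omega
  · have hiJ : i ∉ (if a ≤ J ∧ J ≤ n then ({J} : Finset ℕ) else ∅) := by
      split_ifs <;> simp [h.ne']
    obtain ⟨k, rfl⟩ : ∃ k, i = k + 1 := ⟨i - 1, by omega⟩
    rw [hgt (by omega : J ≤ k), hgt (by omega : J ≤ k + 1), Nat.add_sub_cancel]
    rcases eq_or_lt_of_le (by omega : J ≤ k) with rfl | h1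
    · have := hw J
      rw [heq]
      constructor
      · omega
      · rintro (h2 | ⟨j, hj, hj'⟩)
        · exact absurd h2 hiJ
        · split_ifs at hj' <;> omega
    · obtain ⟨l, rfl⟩ : ∃ l, k = l + 1 := ⟨k - 1, by omega⟩
      rw [hgt (by omega : J ≤ l)]
      constructor
      · intro h2
        exact Or.inr ⟨l + 1, ⟨by omega, by omega, by omega, h2.2⟩, if_neg (by omega)⟩
      · rintro (h2 | ⟨j, hj, hj'⟩)
        · exact absurd h2 hiJ
        · split_ifs at hj'
          · omega
          · obtain rfl : j = l + 1 := by omega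
            exact ⟨by omega, hj.2.2.2⟩

/-- Inserting a new largest letter creates a peak, unless it is inserted at one of the two ends
or next to an old peak, which is then lost. -/
theorem card_peakSet_insertWord {a n J : ℕ} {w : ℕ → ℕ} (hw : ∀ i, w i ≤ n) (ha : 1 ≤ a)
    (ha' : a ≤ 2) (hJ : 1 ≤ J) (hJn : J ≤ n + 1) :
    (peakSet a (n + 1) (insertWord J (n + 1) w)).card =
      if J ∈ Finset.Icc a n \ (peakSet a n w ∪ (peakSet a n w).image (· + 1)) then
        (peakSet a n w).card + 1 else (peakSet a n w).card := by
  have hinj : Function.Injective fun i => if i < J then i else i + 1 := by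
    intro i j h
    dsimp only at h
    split_ifs at h <;> omega
  have himage : J ∈ (peakSet a n w).image (· + 1) ↔ J - 1 ∈ peakSet a n w := by
    obtain ⟨k, rfl⟩ : ∃ k, J = k + 1 := ⟨J - 1, by omega⟩
    simp
  -- At most one old peak is lost, so next to an old peak the gain and the loss cancel.
  have hadj : J - 1 ∈ peakSet a n w → J ∉ peakSet a n w := fun h => by
    have := succ_notMem_peakSet h
    rwa [Nat.sub_add_cancel hJ] at this
  have hne : J - 1 ≠ J := by omega
  rw [peakSet_insertWord hw ha ha' hJ hJn, Finset.card_union_of_disjoint,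
    Finset.card_image_of_injective _ hinj]
  · simp only [Finset.mem_sdiff, Finset.mem_union, himage, Finset.mem_Icc]
    by_cases hmid : a ≤ J ∧ J ≤ n
    · by_cases h1 : J - 1 ∈ peakSet a n w
      · have h2 := hadj h1
        have := Finset.card_pos.2 ⟨_, h1⟩
        simp [hmid, h1, h2, Finset.card_erase_of_mem]
        omega
      · by_cases h2 : J ∈ peakSet a n w
        · have := Finset.card_pos.2 ⟨_, h2⟩
          simp [hmid, h1, h2, Finset.card_erase_of_mem]
          omega
        · simp [hmid, h1, h2, add_comm]
    · have h1 : J - 1 ∉ peakSet a n w := by rw [mem_peakSet]; omega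
      have h2 : J ∉ peakSet a n w := by rw [mem_peakSet]; omega
      simp [hmid, h1, h2]
  · rw [Finset.disjoint_left]
    intro i hi hi'
    obtain rfl : i = J := by
      split_ifs at hi
      · simpa using hi
      · simp at hi
    obtain ⟨j, -, hj⟩ := Finset.mem_image.1 hi'
    split_ifs at hj <;> omega

theorem peakSet_union_image_subset (a n : ℕ) (w : ℕ → ℕ) :
    peakSet a n w ∪ (peakSet a n w).image (· + 1) ⊆ Finset.Icc a n := by
  intro i hi
  simp only [Finset.mem_union, Finset.mem_image, mem_peakSet] at hi
  rw [Finset.mem_Icc]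
  rcases hi with hi | ⟨j, hj, rfl⟩ <;> omega

/-- Each peak i spoils the two slots i and i + 1; no slot is counted twice, since adjacent positions
are never both peaks. -/
theorem card_peakSet_union_image (a n : ℕ) (w : ℕ → ℕ) :
    (peakSet a n w ∪ (peakSet a n w).image (· + 1)).card = 2 * (peakSet a n w).card := by
  rw [Finset.card_union_of_disjoint, Finset.card_image_of_injective _ (add_left_injective 1),
    two_mul]
  rw [Finset.disjoint_left]
  intro i hi hi'
  obtain ⟨j, hj, rfl⟩ := Finset.mem_image.1 hi'
  exact succ_notMem_peakSet hj hi

/-- The sum of a function of the number of peaks, over all insertions of a new largest letter. -/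
theorem sum_card_peakSet_insertWord {a n : ℕ} {w : ℕ → ℕ} (hw : ∀ i, w i ≤ n) (ha : 1 ≤ a)
    (ha' : a ≤ 2) (han : a ≤ n + 1) (f : ℕ → ℚ) :
    ∑ j : Fin (n + 1), f (peakSet a (n + 1) (insertWord (j + 1) (n + 1) w)).card =
      (2 * (peakSet a n w).card + a) * f (peakSet a n w).card +
        (n + 1 - a - 2 * (peakSet a n w).card) * f ((peakSet a n w).card + 1) := by
  set p := (peakSet a n w).card with hp
  set S := Finset.Icc a n \ (peakSet a n w ∪ (peakSet a n w).image (· + 1)) with hS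
  have hSc : (S.card : ℚ) = n + 1 - a - 2 * p := by
    rw [hS, Finset.cast_card_sdiff (peakSet_union_image_subset a n w), card_peakSet_union_image,
      Nat.card_Icc, ← hp, Nat.cast_sub han]
    push_cast
    ring
  have hsub : S ⊆ Finset.Ico 1 (n + 2) := by
    intro i hi
    have := (Finset.mem_Icc.1 (Finset.mem_sdiff.1 hi).1)
    rw [Finset.mem_Ico]
    omega
  have hsum : ∑ j : Fin (n + 1), f (peakSet a (n + 1) (insertWord (j + 1) (n + 1) w)).card =
      ∑ J ∈ Finset.Ico 1 (n + 2), if J ∈ S then f (p + 1) else f p := by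
    rw [Fin.sum_univ_eq_sum_range
        (fun j => f (peakSet a (n + 1) (insertWord (j + 1) (n + 1) w)).card),
      Finset.sum_Ico_eq_sum_range]
    refine Finset.sum_congr (by simp) fun j hj => ?_
    rw [Finset.mem_range] at hj
    rw [card_peakSet_insertWord hw ha ha' (by omega) (by omega), ← hS, ← hp, add_comm 1 j]
    split_ifs <;> rfl
  rw [hsum, ← Finset.sum_sdiff hsub, Finset.sum_congr rfl fun J hJ => if_neg (Finset.mem_sdiff.1 hJ).2,
    Finset.sum_congr (s₁ := S) rfl fun J hJ => if_pos hJ, Finset.sum_const, Finset.sum_const,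
    nsmul_eq_mul, nsmul_eq_mul, Finset.cast_card_sdiff hsub, hSc, Nat.card_Ico]
  push_cast [Nat.add_sub_cancel]
  ring

/-! ### Insertion as a bijection on permutations -/

/-- The permutation of `Fin (n + 1)` whose one-line notation is that of `σ` with a new largest
letter inserted at position `j`. -/
def insertLast {n : ℕ} (j : Fin (n + 1)) (σ : Equiv.Perm (Fin n)) : Equiv.Perm (Fin (n + 1)) :=
  ((finSuccEquiv' j).trans (Equiv.optionCongr σ)).trans (finSuccEquiv' (Fin.last n)).symm

@[simp]
theorem insertLast_self {n : ℕ} (j : Fin (n + 1)) (σ : Equiv.Perm (Fin n)) :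
    insertLast j σ j = Fin.last n := by
  simp [insertLast]

@[simp]
theorem insertLast_succAbove {n : ℕ} (j : Fin (n + 1)) (σ : Equiv.Perm (Fin n)) (i : Fin n) :
    insertLast j σ (j.succAbove i) = (σ i).castSucc := by
  simp [insertLast]

/-- The position of the largest letter recovers j, and the remaining letters recover σ; the
cardinalities agree because (n+1)! = (n+1) · n!. -/
theorem insertLast_bijective (n : ℕ) :
    Function.Bijective fun x : Equiv.Perm (Fin n) × Fin (n + 1) => insertLast x.2 x.1 := by
  rw [Fintype.bijective_iff_injective_and_card]
  constructor
  · rintro ⟨σ, j⟩ ⟨τ, k⟩ h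
    dsimp only at h
    obtain rfl : j = k := by
      apply (insertLast j σ).injective
      rw [insertLast_self, h, insertLast_self]
    congr 1
    ext i
    have := congrArg (fun ρ => (ρ (j.succAbove i) : ℕ)) h
    simpa using this
  · simp [Fintype.card_perm, Nat.factorial_succ, mul_comm]

theorem permWord_le {n : ℕ} (σ : Equiv.Perm (Fin n)) (i : ℕ) : permWord σ i ≤ n := by
  unfold permWord
  split_ifs with h
  · exact (σ _).isLt
  · exact Nat.zero_le n

theorem permWord_insertLast {n : ℕ} (j : Fin (n + 1)) (σ : Equiv.Perm (Fin n)) :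
    permWord (insertLast j σ) = insertWord (j + 1) (n + 1) (permWord σ) := by
  funext i
  have hj := j.isLt
  unfold insertWord
  rcases lt_trichotomy i (j + 1) with h | rfl | h
  · rw [if_pos h]
    unfold permWord
    by_cases hi : 1 ≤ i
    · rw [dif_pos ⟨hi, by omega⟩, dif_pos ⟨hi, by omega⟩]
      have : (⟨i - 1, by omega⟩ : Fin (n + 1)) = j.succAbove ⟨i - 1, by omega⟩ := by
        rw [Fin.succAbove_of_castSucc_lt _ _ (by rw [Fin.lt_def]; simp; omega)]
        rfl
      rw [this, insertLast_succAbove]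
      simp
    · rw [dif_neg (by omega), dif_neg (by omega)]
  · simp [permWord, Nat.le_of_lt_succ hj]
  · rw [if_neg (by omega), if_neg (by omega)]
    unfold permWord
    by_cases hi : i ≤ n + 1
    · rw [dif_pos ⟨by omega, hi⟩, dif_pos ⟨by omega, by omega⟩]
      have : (⟨i - 1, by omega⟩ : Fin (n + 1)) = j.succAbove ⟨i - 1 - 1, by omega⟩ := by
        rw [Fin.succAbove_of_le_castSucc _ _ (by rw [Fin.le_def]; simp; omega)]
        ext
        simp
        omega
      rw [this, insertLast_succAbove]
      simp
    · rw [dif_neg (by omega), dif_neg (by omega)]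

theorem sum_perm_peakSet_succ {a n : ℕ} (ha : 1 ≤ a) (ha' : a ≤ 2) (han : a ≤ n + 1) (f : ℕ → ℚ) :
    ∑ σ : Equiv.Perm (Fin (n + 1)), f (peakSet a (n + 1) (permWord σ)).card =
      ∑ σ : Equiv.Perm (Fin n),
        ((2 * (peakSet a n (permWord σ)).card + a) * f (peakSet a n (permWord σ)).card +
          (n + 1 - a - 2 * (peakSet a n (permWord σ)).card) *
            f ((peakSet a n (permWord σ)).card + 1)) := by
  rw [← (insertLast_bijective n).sum_comp
    (fun σ => f (peakSet a (n + 1) (permWord σ)).card), Fintype.sum_prod_type]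
  refine Finset.sum_congr rfl fun σ _ => ?_
  simp only [permWord_insertLast]
  exact sum_card_peakSet_insertWord (permWord_le σ) ha ha' han f

/-! ### Recurrences for the two peak numbers -/

theorem augmentedPeakNumber_eq {n : ℕ} (σ : Equiv.Perm (Fin n)) :
    augmentedPeakNumber σ = (peakSet 1 n (permWord σ)).card := rfl

theorem interiorPeakNumber_eq {n : ℕ} (σ : Equiv.Perm (Fin n)) :
    interiorPeakNumber σ = (peakSet 2 n (permWord σ)).card := by
  unfold interiorPeakNumber
  congr 1
  ext i
  simp only [interiorPeakSet, mem_peakSet, Finset.mem_filter, Finset.mem_Ico]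
  omega

/-- The 2p slots spoiled by the peaks lie in [2, n], which has n - 1 elements. For even n this
sharpens `interiorPeakNumber_le`. -/
theorem two_mul_interiorPeakNumber_lt {n : ℕ} (hn : 1 ≤ n) (σ : Equiv.Perm (Fin n)) :
    2 * interiorPeakNumber σ < n := by
  have := Finset.card_le_card (peakSet_union_image_subset 2 n (permWord σ))
  rw [card_peakSet_union_image, ← interiorPeakNumber_eq, Nat.card_Icc] at this
  omega

/-- The recurrence for the distribution of augmented peaks, in summed form. -/
theorem sum_augmentedPeakNumber_succ (n : ℕ) (f : ℕ → ℚ) :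
    ∑ σ : Equiv.Perm (Fin (n + 1)), f (augmentedPeakNumber σ) =
      ∑ σ : Equiv.Perm (Fin n),
        ((2 * augmentedPeakNumber σ + 1) * f (augmentedPeakNumber σ) +
          (n - 2 * augmentedPeakNumber σ) * f (augmentedPeakNumber σ + 1)) := by
  simp only [augmentedPeakNumber_eq]
  rw [sum_perm_peakSet_succ le_rfl one_le_two (by omega)]
  simp

/-- The recurrence for the distribution of interior peaks, in summed form. -/
theorem sum_interiorPeakNumber_succ {n : ℕ} (hn : 1 ≤ n) (f : ℕ → ℚ) :
    ∑ σ : Equiv.Perm (Fin (n + 1)), f (interiorPeakNumber σ) =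
      ∑ σ : Equiv.Perm (Fin n),
        ((2 * interiorPeakNumber σ + 2) * f (interiorPeakNumber σ) +
          (n - 1 - 2 * interiorPeakNumber σ) * f (interiorPeakNumber σ + 1)) := by
  simp only [interiorPeakNumber_eq]
  rw [sum_perm_peakSet_succ one_le_two le_rfl (by omega)]
  refine Finset.sum_congr rfl fun σ _ => ?_
  push_cast
  ring

/-! ### Relations between bivariate Catalan numbers -/

theorem bivariateCatalan_succ_left (m n : ℕ) :
    (2 * n + 1) * bivariateCatalan (m + 1) n = (2 * m + 1) * bivariateCatalan m (n + 1) := by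
  unfold bivariateCatalan
  rw [show 2 * (m + 1) = 2 * m + 1 + 1 by ring, show 2 * (n + 1) = 2 * n + 1 + 1 by ring,
    show m + (n + 1) = m + 1 + n by ring]
  simp only [Nat.factorial_succ (2 * m + 1), Nat.factorial_succ (2 * m), Nat.factorial_succ m,
    Nat.factorial_succ (2 * n + 1), Nat.factorial_succ (2 * n), Nat.factorial_succ n]
  push_cast
  field_simp
  ring

/-- The ratios of the two terms to C(m,n) are 2(2m+1)/(m+n+1) and 2(2n+1)/(m+n+1), which add up to
4. -/
theorem bivariateCatalan_succ_add_succ (m n : ℕ) :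
    bivariateCatalan (m + 1) n + bivariateCatalan m (n + 1) = 4 * bivariateCatalan m n := by
  unfold bivariateCatalan
  rw [show 2 * (m + 1) = 2 * m + 1 + 1 by ring, show 2 * (n + 1) = 2 * n + 1 + 1 by ring,
    show m + (n + 1) = m + n + 1 by ring, show m + 1 + n = m + n + 1 by ring]
  simp only [Nat.factorial_succ (2 * m + 1), Nat.factorial_succ (2 * m), Nat.factorial_succ m,
    Nat.factorial_succ (2 * n + 1), Nat.factorial_succ (2 * n), Nat.factorial_succ n,
    Nat.factorial_succ (m + n)]
  push_cast
  field_simp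
  ring

theorem bivariateCatalan_zero_zero : bivariateCatalan 0 0 = 1 := by
  simp [bivariateCatalan]

/-! ### Evaluation of the alternating sums -/

/-- The alternating Catalan sum over the augmented peak numbers vanishes in even length. -/
theorem sum_augmentedPeakNumber_bivariateCatalan (N : ℕ) :
    ∑ σ : Equiv.Perm (Fin (2 * N + 1 + 1)),
      (-1 : ℚ) ^ augmentedPeakNumber σ *
        bivariateCatalan (augmentedPeakNumber σ) (N + 1 - augmentedPeakNumber σ) = 0 := by
  rw [sum_augmentedPeakNumber_succ (2 * N + 1)
    (fun k => (-1 : ℚ) ^ k * bivariateCatalan k (N + 1 - k))]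
  refine Finset.sum_eq_zero fun σ _ => ?_
  -- With m = N - k the raising coefficient 2N + 1 - 2k is 2m + 1, as in
  -- `bivariateCatalan_succ_left`.
  obtain ⟨m, hm⟩ : ∃ m, N = augmentedPeakNumber σ + m :=
    Nat.exists_eq_add_of_le (by have := augmentedPeakNumber_le σ; omega)
  generalize augmentedPeakNumber σ = k at hm
  rw [show N + 1 - k = m + 1 by omega, show N + 1 - (k + 1) = m by omega, hm]
  have := bivariateCatalan_succ_left k m
  push_cast
  linear_combination (-1 : ℚ) ^ (k + 1) * this

/-- With N = k + m + 1 the coefficients are 2k + 2 and 2m + 1, so each summand collapses to ((2k+2)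
- (2k+1)) C(k,m+1), up to sign. -/
theorem sum_interiorPeakNumber_bivariateCatalan_even_succ {N : ℕ} (hN : 1 ≤ N) :
    ∑ σ : Equiv.Perm (Fin (2 * N + 1)),
      (-1 : ℚ) ^ interiorPeakNumber σ *
        bivariateCatalan (interiorPeakNumber σ) (N - interiorPeakNumber σ) =
    ∑ σ : Equiv.Perm (Fin (2 * N)),
      (-1 : ℚ) ^ interiorPeakNumber σ *
        bivariateCatalan (interiorPeakNumber σ) (N - interiorPeakNumber σ) := by
  rw [sum_interiorPeakNumber_succ (by omega)
    (fun k => (-1 : ℚ) ^ k * bivariateCatalan k (N - k))]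
  refine Finset.sum_congr rfl fun σ _ => ?_
  -- The strict bound 2k < 2N keeps the index N - (k + 1) from truncating.
  obtain ⟨m, hm⟩ : ∃ m, N = interiorPeakNumber σ + m + 1 := by
    have := two_mul_interiorPeakNumber_lt (by omega) σ
    exact ⟨N - interiorPeakNumber σ - 1, by omega⟩
  generalize interiorPeakNumber σ = k at hm
  rw [show N - k = m + 1 by omega, show N - (k + 1) = m by omega, hm]
  have := bivariateCatalan_succ_left k m
  push_cast
  linear_combination (-1 : ℚ) ^ (k + 1) * this

/-- With N = k + m the coefficients are 2k + 2 and 2m. The parts 2k + 1 and 2m + 1 cancel, leaving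
C(k,m+1) + C(k+1,m) = 4 C(k,m), up to sign. -/
theorem sum_interiorPeakNumber_bivariateCatalan_odd_succ (N : ℕ) :
    ∑ σ : Equiv.Perm (Fin (2 * N + 1 + 1)),
      (-1 : ℚ) ^ interiorPeakNumber σ *
        bivariateCatalan (interiorPeakNumber σ) (N + 1 - interiorPeakNumber σ) =
    4 * ∑ σ : Equiv.Perm (Fin (2 * N + 1)),
      (-1 : ℚ) ^ interiorPeakNumber σ *
        bivariateCatalan (interiorPeakNumber σ) (N - interiorPeakNumber σ) := by
  rw [sum_interiorPeakNumber_succ (by omega)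
    (fun k => (-1 : ℚ) ^ k * bivariateCatalan k (N + 1 - k)), Finset.mul_sum]
  refine Finset.sum_congr rfl fun σ _ => ?_
  obtain ⟨m, hm⟩ : ∃ m, N = interiorPeakNumber σ + m :=
    Nat.exists_eq_add_of_le (by have := interiorPeakNumber_le σ; omega)
  generalize interiorPeakNumber σ = k at hm
  rw [show N + 1 - k = m + 1 by omega, show N + 1 - (k + 1) = m by omega,
    show N - k = m by omega, hm]
  have h1 := bivariateCatalan_succ_left k m
  have h2 := bivariateCatalan_succ_add_succ k m
  push_cast
  linear_combination (-1 : ℚ) ^ (k + 1) * h1 + (-1 : ℚ) ^ k * h2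

theorem sum_interiorPeakNumber_bivariateCatalan_odd (N : ℕ) :
    ∑ σ : Equiv.Perm (Fin (2 * N + 1)),
      (-1 : ℚ) ^ interiorPeakNumber σ *
        bivariateCatalan (interiorPeakNumber σ) (N - interiorPeakNumber σ) = 4 ^ N := by
  induction N with
  | zero =>
    have h0 (σ : Equiv.Perm (Fin (2 * 0 + 1))) : interiorPeakNumber σ = 0 := by
      have := interiorPeakNumber_le σ
      omega
    simp [h0, bivariateCatalan_zero_zero]
  | succ N ih =>
    rw [sum_interiorPeakNumber_bivariateCatalan_even_succ (by omega),
      show 2 * (N + 1) = 2 * N + 1 + 1 by ring,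
      sum_interiorPeakNumber_bivariateCatalan_odd_succ, ih, pow_succ']

theorem corollaryC :
    (∀ n : ℕ,
      ∑ σ : Equiv.Perm (Fin n),
        (-1 : ℚ) ^ interiorPeakNumber σ *
          bivariateCatalan (interiorPeakNumber σ) (n / 2 - interiorPeakNumber σ) =
        4 ^ (n / 2)) ∧
    (∀ n : ℕ, 0 < n → Even n →
      ∑ σ : Equiv.Perm (Fin n),
        (-1 : ℚ) ^ augmentedPeakNumber σ *
          bivariateCatalan (augmentedPeakNumber σ) (n / 2 - augmentedPeakNumber σ) =
        0) := by
  constructor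
  · intro n
    obtain ⟨N, rfl | rfl⟩ := n.even_or_odd'
    · cases N with
      | zero =>
        -- Length 0 has no odd predecessor, so it is evaluated directly.
        have h0 (σ : Equiv.Perm (Fin (2 * 0))) : interiorPeakNumber σ = 0 := by
          have := interiorPeakNumber_le σ
          omega
        simp [h0, bivariateCatalan_zero_zero]
      | succ N =>
        rw [show 2 * (N + 1) / 2 = N + 1 by omega, show 2 * (N + 1) = 2 * N + 1 + 1 by ring,
          sum_interiorPeakNumber_bivariateCatalan_odd_succ,
          sum_interiorPeakNumber_bivariateCatalan_odd, pow_succ']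
    · rw [show (2 * N + 1) / 2 = N by omega]
      exact sum_interiorPeakNumber_bivariateCatalan_odd N
  · rintro n hn ⟨N, rfl⟩
    obtain ⟨M, rfl⟩ : ∃ M, N = M + 1 := ⟨N - 1, by omega⟩
    rw [show (M + 1 + (M + 1)) / 2 = M + 1 by omega,
      show M + 1 + (M + 1) = 2 * M + 1 + 1 by ring]
    exact sum_augmentedPeakNumber_bivariateCatalan M
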